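/- All manifolds are finite-dimensional, Hausdorff, second countable and smooth, and all maps between them are smooth. A \emph{fibration} is a surjective submersion. Let $(M,\Xi)$ be a Poisson manifold (so $\Xi$ is a smooth antisymmetric tensor $T^*M\times T^*M\to\mathbb{R}$ such that $\{f,g\}=\Xi(df,dg)$ satisfies the Jacobi identity), let $\Xi^\sharp:T^*M\to TM$ be given by $\langle\alpha,\Xi^\sharp(\beta)\rangle=\Xi(\alpha,\beta)$, let $H:M\to\mathbb{R}$ be a function with Hamiltonian vector field $X_H=\Xi^\sharp\circ dH$, and let $\Pi:M\to N$ be a fibration. A subspace $V\subset T_mM$ with annihilator $V^0\subset T_m^*M$ is \emph{isotropic} if $V\cap\operatorname{Im}\Xi^\sharp\subset\Xi^\sharp(V^0)$ and $V\subset\operatorname{Im}\Xi^\sharp$, and \emph{Lagrangian} if moreover $\Xi^\sharp(V^0)\subset V$. A fibration $F$ is isotropic (Lagrangian) if every fiber of $\operatorname{Ker}F_*$ is, and two fibrations $\Pi,F$ on $M$ are \emph{transverse} if $TM=\operatorname{Ker}\Pi_*\oplus\operatorname{Ker}F_*$. A \emph{complete solution} of the $\Pi$-Hamilton--Jacobi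 equation ($\Pi$-HJE) for $(M,X)$, $X$ a vector field on $M$, is a surjective local diffeomorphism $\Sigma:N\times\Lambda\to M$, with $\Lambda$ a manifold of dimension $\dim M-\dim N$, such that for every $\lambda\in\Lambda$ the map $\sigma_\lambda=\Sigma(\cdot,\lambda):N\to M$ is a section of $\Pi$ with $(\sigma_\lambda)_*\circ\Pi_*\circ X\circ\sigma_\lambda=X\circ\sigma_\lambda$. It is \emph{Lagrangian} if for all $\lambda\in\Lambda$ and $n\in N$ the subspace $\operatorname{Im}(\sigma_\lambda)_{*,n}\subset T_{\sigma_\lambda(n)}M$ is Lagrangian. The system $(M,X_H)$ is \emph{commutative integrable (CI) by means of} a fibration $F:M\to\Lambda$ if $F$ is Lagrangian, $X_H$ takes values in $\operatorname{Ker}F_*$, and the distribution $\Xi^\sharp[(\operatorname{Ker}F_*)^0]$ is integrable (i.e. has an integral manifold through every point); it is CI if it is CI by means of some fibration $F$ onto some manifold. An open subset $U\subset M$ is considered with the Poisson structure $\Xi|_U$ and the function $H|_U$, whose Hamiltonian vector field is $X_H|_U$. Then: 1. If there is a Lagrangian complete solution $\Sigma:N\times\Lambda\to M$ of the $\Pi$-HJE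 for $(M,X_H)$, then every $m\in M$ has an open neighborhood $U$ such that $(U,X_H|_U)$ is CI. 2. If $(M,X_H)$ is CI by means of $F$, with $F$ and $\Pi$ transverse, then every $m\in M$ has an open neighborhood $U$ such that there is a Lagrangian complete solution of the $\Pi|_U$-HJE for $(U,X_H|_U)$, where $\Pi|_U:U\to\Pi(U)$ is the restricted fibration. 3. If $(M,X_H)$ is CI, then for every $m\in M$ there are an open neighborhood $U$ of $m$ and a fibration $\pi:U\to\pi(U)$ onto an open subset $\pi(U)$ of some $\mathbb{R}^r$ such that there is a Lagrangian complete solution of the $\pi$-HJE for $(U,X_H|_U)$. -/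

import Mathlib

open scoped Manifold ContDiff
open Set TopologicalSpace Bundle

universe u v w

namespace HamiltonJacobi

noncomputable section

section Basic

variable {d : ℕ} {M : Type*} [TopologicalSpace M] [ChartedSpace (EuclideanSpace ℝ (Fin d)) M]
variable {k : ℕ} {N : Type*} [TopologicalSpace N] [ChartedSpace (EuclideanSpace ℝ (Fin k)) N]

/-- The cotangent space `T*_m M` of a `d`-manifold. -/
abbrev Cotangent (d : ℕ) {M : Type*} [TopologicalSpace M]
    [ChartedSpace (EuclideanSpace ℝ (Fin d)) M] (m : M) : Type :=
  Module.Dual ℝ (TangentSpace (𝓡 d) m)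

/-- The differential `df(m) ∈ T*_m M` of a real function. -/
def differential (d : ℕ) {M : Type*} [TopologicalSpace M]
    [ChartedSpace (EuclideanSpace ℝ (Fin d)) M] (f : M → ℝ) (m : M) : Cotangent d m :=
  (mfderiv (𝓡 d) 𝓘(ℝ, ℝ) f m).toLinearMap

/-- A fibration: a smooth surjective submersion. -/
structure IsFibration (p : M → N) : Prop where
  smooth : ContMDiff (𝓡 d) (𝓡 k) ∞ p
  surjective : Function.Surjective p
  submersion : ∀ m, Function.Surjective (mfderiv (𝓡 d) (𝓡 k) p m)

/-- The vertical space `Ker p_{*,m}`. -/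
def vertical (p : M → N) (m : M) : Submodule ℝ (TangentSpace (𝓡 d) m) :=
  LinearMap.ker (mfderiv (𝓡 d) (𝓡 k) p m).toLinearMap

/-- Two maps are transverse if `TM = Ker p_* ⊕ Ker q_*`. -/
def Transverse {l : ℕ} {Λ : Type*} [TopologicalSpace Λ]
    [ChartedSpace (EuclideanSpace ℝ (Fin l)) Λ] (p : M → N) (q : M → Λ) : Prop :=
  ∀ m, IsCompl (vertical (d := d) (k := k) p m) (vertical (d := d) (k := l) q m)

/-- The restriction `U → f(U)` of a map, where `V = f(U)` is open. -/
def restrictMap (f : M → N) (U : Opens M) (V : Opens N) (h : f '' U = V) : U → V :=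
  fun u => ⟨f u, h.subset (mem_image_of_mem f u.2)⟩

/-- A (possibly singular) distribution on `M` is integrable if through every point of `M` there
passes an integral manifold: an injectively immersed submanifold (here given by a parametrization
by an open subset of a Euclidean space) whose tangent spaces are the fibers of the distribution. -/
def IsIntegrable (D : ∀ m : M, Submodule ℝ (TangentSpace (𝓡 d) m)) : Prop :=
  ∀ m : M, ∃ (r : ℕ) (W : Set (EuclideanSpace ℝ (Fin r))) (j : EuclideanSpace ℝ (Fin r) → M),
    IsOpen W ∧ 0 ∈ W ∧ j 0 = m ∧ ContMDiffOn (𝓡 r) (𝓡 d) ∞ j W ∧ InjOn j W ∧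
    ∀ w ∈ W, Function.Injective (mfderiv (𝓡 r) (𝓡 d) j w) ∧
      LinearMap.range (mfderiv (𝓡 r) (𝓡 d) j w).toLinearMap = D (j w)

end Basic

section Poisson

/-- A field of bilinear forms `Ξ_m : T*_m M × T*_m M → ℝ`. -/
abbrev BivectorField (d : ℕ) (M : Type*) [TopologicalSpace M]
    [ChartedSpace (EuclideanSpace ℝ (Fin d)) M] : Type _ :=
  ∀ m : M, Cotangent d m →ₗ[ℝ] Cotangent d m →ₗ[ℝ] ℝ

variable {d : ℕ} {M : Type*} [TopologicalSpace M] [ChartedSpace (EuclideanSpace ℝ (Fin d)) M]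

/-- The bracket `{f, g} = Ξ(df, dg)`. -/
def bracket (Ξ : BivectorField d M) (f g : M → ℝ) : M → ℝ :=
  fun m => Ξ m (differential d f m) (differential d g m)

/-- Poisson structures: smooth antisymmetric tensors whose bracket satisfies the Jacobi identity.
Smoothness means that the components `Ξ(dxⁱ, dxʲ)` in every chart `x = (x¹, …, xᵈ)` of the atlas
are smooth functions. -/
structure IsPoisson (Ξ : BivectorField d M) : Prop where
  smooth : ∀ e ∈ atlas (EuclideanSpace ℝ (Fin d)) M, ∀ i j : Fin d,
    ContMDiffOn (𝓡 d) 𝓘(ℝ, ℝ) ∞ (bracket Ξ (fun y => e y i) (fun y => e y j)) e.source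
  antisymm : ∀ m (α β : Cotangent d m), Ξ m α β = -Ξ m β α
  jacobi : ∀ f g h : M → ℝ, ContMDiff (𝓡 d) 𝓘(ℝ, ℝ) ∞ f → ContMDiff (𝓡 d) 𝓘(ℝ, ℝ) ∞ g →
    ContMDiff (𝓡 d) 𝓘(ℝ, ℝ) ∞ h → ∀ m,
      bracket Ξ (bracket Ξ f g) h m + bracket Ξ (bracket Ξ h f) g m
        + bracket Ξ (bracket Ξ g h) f m = 0

instance finiteDimensional_tangentSpace (m : M) : FiniteDimensional ℝ (TangentSpace (𝓡 d) m) :=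
  inferInstanceAs (FiniteDimensional ℝ (EuclideanSpace ℝ (Fin d)))

/-- `Ξ♯_m : T*_m M → T_m M`, determined by `⟨α, Ξ♯ β⟩ = Ξ(α, β)` (see `apply_sharp`). -/
def sharp (Ξ : BivectorField d M) (m : M) : Cotangent d m →ₗ[ℝ] TangentSpace (𝓡 d) m :=
  (Module.evalEquiv ℝ (TangentSpace (𝓡 d) m)).symm.toLinearMap ∘ₗ (Ξ m).flip

theorem apply_sharp (Ξ : BivectorField d M) (m : M) (α β : Cotangent d m) :
    α (sharp Ξ m β) = Ξ m α β :=
  Module.apply_evalEquiv_symm_apply ℝ (TangentSpace (𝓡 d) m) α ((Ξ m).flip β)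

/-- The Hamiltonian vector field `X_H = Ξ♯ ∘ dH`. -/
def hamiltonianVectorField (Ξ : BivectorField d M) (H : M → ℝ) (m : M) :
    TangentSpace (𝓡 d) m :=
  sharp Ξ m (differential d H m)

/-- The pull-back `Φ*Ξ` along a local diffeomorphism:
`(Φ*Ξ)_p(α, β) = Ξ_{Φ(p)}(α ∘ (Φ_{*,p})⁻¹, β ∘ (Φ_{*,p})⁻¹)`. -/
def pullbackBivector {P : Type*} [TopologicalSpace P] [ChartedSpace (EuclideanSpace ℝ (Fin d)) P]
    (Φ : P → M) (Ξ : BivectorField d M) : BivectorField d P := fun p =>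
  (Ξ (Φ p)).compl₁₂
    (mfderiv (𝓡 d) (𝓡 d) Φ p).inverse.toLinearMap.dualMap
    (mfderiv (𝓡 d) (𝓡 d) Φ p).inverse.toLinearMap.dualMap

/-- The restriction of `Ξ` to an open submanifold. -/
def restrictBivector (Ξ : BivectorField d M) (U : Opens M) : BivectorField d U :=
  pullbackBivector (Subtype.val : U → M) Ξ

/-- The Poisson orthogonal `Ξ♯(V⁰)`, where `V⁰ ⊂ T*_m M` is the annihilator of `V`. -/
def orthogonal (Ξ : BivectorField d M) {m : M} (V : Submodule ℝ (TangentSpace (𝓡 d) m)) :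
    Submodule ℝ (TangentSpace (𝓡 d) m) :=
  V.dualAnnihilator.map (sharp Ξ m)

def IsWeaklyIsotropic (Ξ : BivectorField d M) {m : M}
    (V : Submodule ℝ (TangentSpace (𝓡 d) m)) : Prop :=
  V ⊓ LinearMap.range (sharp Ξ m) ≤ orthogonal Ξ V

def IsCoisotropic (Ξ : BivectorField d M) {m : M}
    (V : Submodule ℝ (TangentSpace (𝓡 d) m)) : Prop :=
  orthogonal Ξ V ≤ V

/-- Isotropic subspaces (for antisymmetric `Ξ`). -/
def IsIsotropic (Ξ : BivectorField d M) {m : M}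
    (V : Submodule ℝ (TangentSpace (𝓡 d) m)) : Prop :=
  IsWeaklyIsotropic Ξ V ∧ V ≤ LinearMap.range (sharp Ξ m)

def IsLagrangian (Ξ : BivectorField d M) {m : M}
    (V : Submodule ℝ (TangentSpace (𝓡 d) m)) : Prop :=
  IsIsotropic Ξ V ∧ IsCoisotropic Ξ V

end Poisson

section HamiltonJacobiEquation

variable {d : ℕ} {M : Type*} [TopologicalSpace M] [ChartedSpace (EuclideanSpace ℝ (Fin d)) M]
variable {k : ℕ} {N : Type*} [TopologicalSpace N] [ChartedSpace (EuclideanSpace ℝ (Fin k)) N]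
variable {l : ℕ} {Λ : Type*} [TopologicalSpace Λ] [ChartedSpace (EuclideanSpace ℝ (Fin l)) Λ]

/-- `σ : N → M` is a (smooth) section of `p : M → N` that solves the `p`-Hamilton-Jacobi equation
`σ_* ∘ p_* ∘ X ∘ σ = X ∘ σ` for the dynamical system `(M, X)`. -/
structure IsSolution (p : M → N) (X : ∀ m : M, TangentSpace (𝓡 d) m) (σ : N → M) : Prop where
  smooth : ContMDiff (𝓡 k) (𝓡 d) ∞ σ
  isSection : ∀ n, p (σ n) = n
  equation : ∀ n, tangentMap (𝓡 k) (𝓡 d) σ (tangentMap (𝓡 d) (𝓡 k) p ⟨σ n, X (σ n)⟩) =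
    (⟨σ n, X (σ n)⟩ : TangentBundle (𝓡 d) M)

/-- `S : N × Λ → M` is a complete solution of the `p`-Hamilton-Jacobi equation for `(M, X)`. -/
structure IsCompleteSolution (p : M → N) (X : ∀ m : M, TangentSpace (𝓡 d) m)
    (S : N × Λ → M) : Prop where
  dim_eq : d = k + l
  surjective : Function.Surjective S
  localDiffeo : IsLocalDiffeomorph ((𝓡 k).prod (𝓡 l)) (𝓡 d) ∞ S
  partialSolution : ∀ lam : Λ, IsSolution (d := d) (k := k) p X (fun n => S (n, lam))

/-- `S : N × Λ → M` is Lagrangian: each `Im (σ_λ)_*`, with `σ_λ = S(·, λ)`, is Lagrangian. -/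
def IsLagrangianFamily (Ξ : BivectorField d M) (S : N × Λ → M) : Prop :=
  ∀ (lam : Λ) (n : N), IsLagrangian Ξ (m := S (n, lam))
    (LinearMap.range (mfderiv (𝓡 k) (𝓡 d) (fun n' => S (n', lam)) n).toLinearMap)

/-- `(M, X_H)` is non-commutative integrable by means of the fibration `F`. -/
structure IsNCIBy (Ξ : BivectorField d M) (H : M → ℝ) (F : M → Λ) : Prop where
  fibration : IsFibration (d := d) (k := l) F
  isotropic : ∀ m, IsIsotropic Ξ (vertical (d := d) (k := l) F m)
  firstIntegrals : ∀ m, hamiltonianVectorField Ξ H m ∈ vertical (d := d) (k := l) F m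
  integrable : IsIntegrable (fun m => orthogonal Ξ (vertical (d := d) (k := l) F m))

/-- `(M, X_H)` is commutative integrable by means of the fibration `F`. -/
structure IsCIBy (Ξ : BivectorField d M) (H : M → ℝ) (F : M → Λ) : Prop extends
    IsNCIBy (d := d) (l := l) Ξ H F where
  lagrangian : ∀ m, IsLagrangian Ξ (vertical (d := d) (k := l) F m)

end HamiltonJacobiEquation

/-- `(M, X_H)` is commutative integrable: it is so by means of some fibration onto some
manifold. -/
def IsCI {d : ℕ} {M : Type u} [TopologicalSpace M] [ChartedSpace (EuclideanSpace ℝ (Fin d)) M]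
    (Ξ : BivectorField d M) (H : M → ℝ) : Prop :=
  ∃ (l : ℕ) (Λ : Type w) (_ : TopologicalSpace Λ)
    (_ : ChartedSpace (EuclideanSpace ℝ (Fin l)) Λ) (_ : IsManifold (𝓡 l) ∞ Λ) (_ : T2Space Λ)
    (_ : SecondCountableTopology Λ) (F : M → Λ), IsCIBy (l := l) Ξ H F

/-- There are a manifold `Λ` and a Lagrangian complete solution `S : N × Λ → M` of the
`p`-Hamilton-Jacobi equation for `(M, X_H)`. -/
def HasLagrangianCompleteSolution {d : ℕ} {M : Type u} [TopologicalSpace M]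
    [ChartedSpace (EuclideanSpace ℝ (Fin d)) M] {k : ℕ} {N : Type v} [TopologicalSpace N]
    [ChartedSpace (EuclideanSpace ℝ (Fin k)) N]
    (Ξ : BivectorField d M) (H : M → ℝ) (p : M → N) : Prop :=
  ∃ (l : ℕ) (Λ : Type w) (_ : TopologicalSpace Λ)
    (_ : ChartedSpace (EuclideanSpace ℝ (Fin l)) Λ) (_ : IsManifold (𝓡 l) ∞ Λ) (_ : T2Space Λ)
    (_ : SecondCountableTopology Λ) (S : N × Λ → M),
    IsCompleteSolution (d := d) (k := k) (l := l) p (hamiltonianVectorField Ξ H) S ∧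
      IsLagrangianFamily (d := d) (k := k) Ξ S

end

end HamiltonJacobi

open HamiltonJacobi

/-! Locally, a complete solution and a fibration complementary to `p` are the same thing: a
diffeomorphism `S : N × Λ → M` with inverse `(p, F)`. The slices `N × {λ}` are at once the images of
the partial sections `σ_λ` and the fibers of `F`, so `Im (σ_λ)_* = Ker F_*`
(`IsProductDiffeo.vertical_snd`), and the Lagrangian condition is the same on both sides. Since `p ∘
σ_λ = id`, the Hamilton-Jacobi equation says exactly that `X_H` is tangent to the slices, i.e. lies
in `Ker F_*`. Integrability comes for free: a Lagrangian subspace equals its Poisson orthogonal, so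
`Ξ♯((Ker F_*)⁰) = Ker F_*`, with the slices as integral manifolds.

Hence all three claims reduce to producing such a product locally. For (1), invert `S` near a point
and let `F` be the second component of the inverse. For (2), transversality makes the derivative of
`(p, F)` invertible, and the inverse function theorem gives `S`. For (3), a chart followed by a
linear projection onto `Ker F_{*,m}` is transverse to `F` at `m`, which is all that the argument for
(2) uses, apart from the dimension count. -/

namespace HamiltonJacobi

/-! ### The inverse function theorem as a local diffeomorphism -/

section InverseFunction

/-- The smooth inverse function theorem in Banach spaces. -/
theorem isLocalDiffeomorphAt_of_hasFDerivAt {E E' : Type*} [NormedAddCommGroup E]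
    [NormedSpace ℝ E] [CompleteSpace E] [NormedAddCommGroup E'] [NormedSpace ℝ E']
    {f : E → E'} {O : Set E} {a : E} (hO : IsOpen O) (ha : a ∈ O) (hf : ContDiffOn ℝ ∞ f O)
    {e : E ≃L[ℝ] E'} (he : HasFDerivAt f (e : E →L[ℝ] E') a) :
    IsLocalDiffeomorphAt 𝓘(ℝ, E) 𝓘(ℝ, E') ∞ f a := by
  have hfa : ∀ x ∈ O, ContDiffAt ℝ ∞ f x := fun x hx => hf.contDiffAt (hO.mem_nhds hx)
  have hinf : (∞ : WithTop ℕ∞) ≠ 0 := by simp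
  have hcont : ContinuousOn (fderiv ℝ f) O := hf.continuousOn_fderiv_of_isOpen hO (by simp)
  let R : Set (E →L[ℝ] E') := range ((↑) : (E ≃L[ℝ] E') → E →L[ℝ] E')
  -- Smoothness of the inverse is needed on the whole target, not only at `f a`. The source is
  -- therefore shrunk to points where the derivative is still invertible, an open condition because
  -- invertible maps form an open set.
  have hO' : IsOpen (O ∩ fderiv ℝ f ⁻¹' R) :=
    hcont.isOpen_inter_preimage hO ContinuousLinearEquiv.isOpen
  let Ψ := ((hfa a ha).toOpenPartialHomeomorph f he hinf).restrOpen _ hO'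
  have hsub : Ψ.source ⊆ O ∩ fderiv ℝ f ⁻¹' R := fun x hx => hx.2
  have ha' : a ∈ Ψ.source :=
    ⟨(hfa a ha).mem_toOpenPartialHomeomorph_source he hinf, ha, e, he.fderiv.symm⟩
  refine ⟨⟨Ψ.toPartialEquiv, Ψ.open_source, Ψ.open_target, ?_, ?_⟩, ha', fun x _ => rfl⟩
  · exact (hf.mono fun x hx => (hsub hx).1).contMDiffOn
  · refine ContDiffOn.contMDiffOn fun y hy => ?_
    obtain ⟨h1, e', h2⟩ := hsub (Ψ.map_target hy)
    refine (Ψ.contDiffAt_symm (f₀' := e') hy ?_ (hfa _ h1)).contDiffWithinAt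
    rw [h2]
    exact ((hfa _ h1).differentiableAt hinf).hasFDerivAt

theorem isLocalDiffeomorphAt_congr {E H M : Type*} [NormedAddCommGroup E] [NormedSpace ℝ E]
    [TopologicalSpace H] {I : ModelWithCorners ℝ E H} [TopologicalSpace M] [ChartedSpace H M]
    {E' H' P : Type*} [NormedAddCommGroup E'] [NormedSpace ℝ E'] [TopologicalSpace H']
    {J : ModelWithCorners ℝ E' H'} [TopologicalSpace P] [ChartedSpace H' P]
    {f g : M → P} {m : M}
    (hf : IsLocalDiffeomorphAt I J ∞ f m) (hfg : g =ᶠ[nhds m] f) :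
    IsLocalDiffeomorphAt I J ∞ g m := by
  obtain ⟨Φ, hm, hΦ⟩ := hf
  obtain ⟨O, hO, hOo, hmO⟩ := eventually_nhds_iff.1 hfg
  let Ψ := Φ.toOpenPartialHomeomorph.restrOpen O hOo
  refine ⟨⟨Ψ.toPartialEquiv, Ψ.open_source, Ψ.open_target, ?_, ?_⟩, ⟨hm, hmO⟩, ?_⟩
  · exact Φ.contMDiffOn_toFun.mono fun x hx => hx.1
  · exact Φ.contMDiffOn_invFun.mono fun x hx => hx.1
  · exact fun x hx => (hO x hx.2).trans (hΦ hx.1)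

variable {E H M : Type*} [NormedAddCommGroup E] [NormedSpace ℝ E] [CompleteSpace E]
  [TopologicalSpace H] {I : ModelWithCorners ℝ E H} [I.Boundaryless]
  [TopologicalSpace M] [ChartedSpace H M] [IsManifold I ∞ M]
  {E' H' P : Type*} [NormedAddCommGroup E'] [NormedSpace ℝ E']
  [TopologicalSpace H'] {J : ModelWithCorners ℝ E' H'} [J.Boundaryless]
  [TopologicalSpace P] [ChartedSpace H' P] [IsManifold J ∞ P]

/-- An extended chart of a boundaryless manifold as a partial diffeomorphism. -/
noncomputable def extChartPartialDiffeomorph (I : ModelWithCorners ℝ E H) [I.Boundaryless] [IsManifold I ∞ M]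
    (m : M) : PartialDiffeomorph I 𝓘(ℝ, E) M E ∞ where
  toPartialEquiv := extChartAt I m
  open_source := isOpen_extChartAt_source m
  open_target := isOpen_extChartAt_target m
  contMDiffOn_toFun := by
    rw [extChartAt_source]
    exact contMDiffOn_extChartAt
  contMDiffOn_invFun := contMDiffOn_extChartAt_symm m

/-- The inverse function theorem for manifolds without boundary. -/
theorem isLocalDiffeomorphAt_of_mfderiv {f : M → P} {O : Set M} {m : M} (hO : IsOpen O)
    (hm : m ∈ O) (hf : ContMDiffOn I J ∞ f O) {e : E ≃L[ℝ] E'}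
    (he : mfderiv I J f m = (e : E →L[ℝ] E')) :
    IsLocalDiffeomorphAt I J ∞ f m := by
  let φ := extChartAt I m
  let ψ := extChartAt J (f m)
  have hfm : ContMDiffAt I J ∞ f m := hf.contMDiffAt (hO.mem_nhds hm)
  have hO₁ : IsOpen (O ∩ f ⁻¹' ψ.source) :=
    hf.continuousOn.isOpen_inter_preimage hO (isOpen_extChartAt_source _)
  have hO₂ : IsOpen (φ.target ∩ φ.symm ⁻¹' (O ∩ f ⁻¹' ψ.source)) :=
    (continuousOn_extChartAt_symm m).isOpen_inter_preimage (isOpen_extChartAt_target m) hO₁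
  have hmem : φ m ∈ φ.target ∩ φ.symm ⁻¹' (O ∩ f ⁻¹' ψ.source) := by
    refine ⟨mem_extChartAt_target m, ?_⟩
    simp only [mem_preimage, φ, extChartAt_to_inv]
    exact ⟨hm, mem_extChartAt_source _⟩
  have hg : ContDiffOn ℝ ∞ (ψ ∘ f ∘ φ.symm) (φ.target ∩ φ.symm ⁻¹' (O ∩ f ⁻¹' ψ.source)) := by
    refine ContMDiffOn.contDiffOn ?_
    have h1 : ContMDiffOn J 𝓘(ℝ, E') ∞ ψ ψ.source := (extChartPartialDiffeomorph J (f m)).contMDiffOn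
    exact h1.comp (hf.comp ((contMDiffOn_extChartAt_symm m).mono inter_subset_left)
      fun x hx => hx.2.1) fun x hx => hx.2.2
  have hder : HasFDerivAt (ψ ∘ f ∘ φ.symm) (e : E →L[ℝ] E') (φ m) := by
    have h := (hfm.mdifferentiableAt (by simp)).hasMFDerivAt
    rw [he] at h
    have h' : HasFDerivWithinAt (ψ ∘ f ∘ φ.symm) (e : E →L[ℝ] E') (range I) (φ m) := h.2
    rwa [I.range_eq_univ, hasFDerivWithinAt_univ] at h'
  have h1 := isLocalDiffeomorphAt_of_hasFDerivAt hO₂ hmem hg hder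
  have hφ : IsLocalDiffeomorphAt I 𝓘(ℝ, E) ∞ φ m :=
    ⟨extChartPartialDiffeomorph I m, mem_extChartAt_source m, fun x _ => rfl⟩
  have hgm : (ψ ∘ f ∘ φ.symm) (φ m) = ψ (f m) := by
    simp [φ]
  have hψ : IsLocalDiffeomorphAt 𝓘(ℝ, E') J ∞ ψ.symm ((ψ ∘ f ∘ φ.symm) (φ m)) := by
    rw [hgm]
    exact ⟨(extChartPartialDiffeomorph J (f m)).symm, mem_extChartAt_target _, fun x _ => rfl⟩
  have h2 := (hφ.comp (K := 𝓘(ℝ, E')) _ h1).comp (K := J) _ hψ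
  refine isLocalDiffeomorphAt_congr h2 ?_
  have hs : φ.source ∩ (O ∩ f ⁻¹' ψ.source) ∈ nhds m :=
    ((isOpen_extChartAt_source m).inter hO₁).mem_nhds
      ⟨mem_extChartAt_source m, hm, mem_extChartAt_source _⟩
  filter_upwards [hs] with x hx
  simp only [Function.comp_apply]
  rw [φ.left_inv hx.1, ψ.left_inv hx.2.2]

end InverseFunction

/-! ### Differentials on open submanifolds -/

section Opens

variable {d : ℕ} {M : Type*} [TopologicalSpace M] [ChartedSpace (EuclideanSpace ℝ (Fin d)) M]
variable {k : ℕ} {N : Type*} [TopologicalSpace N] [ChartedSpace (EuclideanSpace ℝ (Fin k)) N]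

/-- The preferred chart of `U` at `x` restricts the one of `M` at `x`, so the inclusion reads as the
identity near `x`. All transfers between `U` and `M` rest on this identification of tangent spaces.
-/
theorem mfderiv_subtype_val (U : Opens M) (x : U) :
    mfderiv (𝓡 d) (𝓡 d) (Subtype.val : U → M) x =
      ContinuousLinearMap.id ℝ (EuclideanSpace ℝ (Fin d)) := by
  have : writtenInExtChartAt (𝓡 d) (𝓡 d) x (Subtype.val : U → M)
      =ᶠ[nhds (extChartAt (𝓡 d) x x)] id := by
    have h := TopologicalSpace.Opens.chartAt_subtype_val_symm_eventuallyEq (H := EuclideanSpace ℝ (Fin d)) U (x := x)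
    have ht : (chartAt (EuclideanSpace ℝ (Fin d)) x.1).target ∈
        nhds (chartAt (EuclideanSpace ℝ (Fin d)) x.1 x.1) :=
      (chartAt _ x.1).open_target.mem_nhds (mem_chart_target _ _)
    filter_upwards [h, ht] with y hy hyt
    have hy' : (((chartAt (EuclideanSpace ℝ (Fin d)) x).symm y : U) : M) =
      (chartAt (EuclideanSpace ℝ (Fin d)) x.1).symm y := hy.symm
    simp only [writtenInExtChartAt, extChartAt, mfld_simps]
    rw [hy']
    exact (chartAt (EuclideanSpace ℝ (Fin d)) x.1).right_inv hyt
  have hmf : HasMFDerivAt (𝓡 d) (𝓡 d) (Subtype.val : U → M) x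
      (ContinuousLinearMap.id ℝ (EuclideanSpace ℝ (Fin d))) :=
    ⟨continuous_subtype_val.continuousAt,
      ((hasFDerivAt_id _).congr_of_eventuallyEq this).hasFDerivWithinAt⟩
  exact hmf.mfderiv

/-- A map of open submanifolds that is the restriction of `f` has the same differential as `f`. -/
theorem mfderiv_of_comp_val {U : Opens M} {V : Opens N} {f : M → N} {g : U → V}
    (hfg : ∀ u, (g u : N) = f u) (u : U) (hf : ContMDiffAt (𝓡 d) (𝓡 k) ∞ f u) :
    mfderiv (𝓡 d) (𝓡 k) g u = mfderiv (𝓡 d) (𝓡 k) f (u : M) := by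
  have hcomp : (Subtype.val : V → N) ∘ g = f ∘ (Subtype.val : U → M) := funext hfg
  have hfv : ContMDiffAt (𝓡 d) (𝓡 k) ∞ (f ∘ (Subtype.val : U → M)) u :=
    hf.comp u (contMDiff_subtype_val u)
  have hg : MDifferentiableAt (𝓡 d) (𝓡 k) g u := by
    rw [← hcomp] at hfv
    exact ((ContMDiffAt.subtypeVal_comp_iff V g u).1 hfv).mdifferentiableAt (by simp)
  have hv : MDifferentiableAt (𝓡 d) (𝓡 d) (Subtype.val : U → M) u :=
    (contMDiff_subtype_val (n := ∞) u).mdifferentiableAt (by simp)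
  have hv' : MDifferentiableAt (𝓡 k) (𝓡 k) (Subtype.val : V → N) (g u) :=
    (contMDiff_subtype_val (n := ∞) (g u)).mdifferentiableAt (by simp)
  have h1 := mfderiv_comp u hv' hg
  have h2 := mfderiv_comp u (hf.mdifferentiableAt (by simp)) hv
  rw [hcomp, h2, mfderiv_subtype_val, mfderiv_subtype_val] at h1
  exact h1.symm

end Opens

/-! ### Restriction of the Poisson data to open sets -/

section Restriction

variable {d : ℕ} {M : Type*} [TopologicalSpace M] [ChartedSpace (EuclideanSpace ℝ (Fin d)) M]

theorem restrictBivector_apply (Ξ : BivectorField d M) (U : Opens M) (u : U) :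
    restrictBivector Ξ U u = Ξ (u : M) := by
  have h : (mfderiv (𝓡 d) (𝓡 d) (Subtype.val : U → M) u).inverse =
      ContinuousLinearMap.id ℝ (EuclideanSpace ℝ (Fin d)) := by
    rw [mfderiv_subtype_val]
    exact ContinuousLinearMap.inverse_id
  unfold restrictBivector pullbackBivector
  rw [h]
  rfl

theorem sharp_restrictBivector (Ξ : BivectorField d M) (U : Opens M) (u : U) :
    sharp (restrictBivector Ξ U) u = sharp Ξ (u : M) := by
  unfold sharp
  rw [restrictBivector_apply]
  rfl

/-- Both tangent spaces unfold to `EuclideanSpace ℝ (Fin d)`, so a single `V` can be read on either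
side. -/
theorem isLagrangian_restrictBivector (Ξ : BivectorField d M) (U : Opens M) (u : U)
    (V : Submodule ℝ (EuclideanSpace ℝ (Fin d))) :
    IsLagrangian (restrictBivector Ξ U) (m := u) V ↔ IsLagrangian Ξ (m := (u : M)) V := by
  unfold IsLagrangian IsIsotropic IsWeaklyIsotropic IsCoisotropic orthogonal
  rw [sharp_restrictBivector]
  rfl

theorem hamiltonianVectorField_restrictBivector (Ξ : BivectorField d M) {H : M → ℝ}
    (U : Opens M) (u : U) (hH : MDifferentiableAt (𝓡 d) 𝓘(ℝ, ℝ) H (u : M)) :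
    hamiltonianVectorField (restrictBivector Ξ U) (fun x : U => H x) u =
      hamiltonianVectorField Ξ H (u : M) := by
  have hv : MDifferentiableAt (𝓡 d) (𝓡 d) (Subtype.val : U → M) u :=
    (contMDiff_subtype_val (n := ∞) u).mdifferentiableAt (by simp)
  have h : mfderiv (𝓡 d) 𝓘(ℝ, ℝ) (fun x : U => H x) u = mfderiv (𝓡 d) 𝓘(ℝ, ℝ) H (u : M) := by
    have h1 := mfderiv_comp u hH hv
    rw [mfderiv_subtype_val] at h1
    exact h1
  unfold hamiltonianVectorField differential
  rw [h, sharp_restrictBivector]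
  rfl

/-- The Poisson orthogonal of a Lagrangian subspace is the subspace itself. -/
theorem IsLagrangian.orthogonal_eq {Ξ : BivectorField d M} {m : M}
    {V : Submodule ℝ (TangentSpace (𝓡 d) m)} (hV : IsLagrangian Ξ V) : orthogonal Ξ V = V :=
  le_antisymm hV.2 fun _ hv => hV.1.1 ⟨hv, hV.1.2 hv⟩

end Restriction

/-! ### Product decompositions and their slices -/

section ProductDiffeomorphism

variable {d : ℕ} {M : Type*} [TopologicalSpace M] [ChartedSpace (EuclideanSpace ℝ (Fin d)) M]
variable {k : ℕ} {N : Type*} [TopologicalSpace N] [ChartedSpace (EuclideanSpace ℝ (Fin k)) N]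
variable {l : ℕ} {Λ : Type*} [TopologicalSpace Λ] [ChartedSpace (EuclideanSpace ℝ (Fin l)) Λ]

/-- `S : N × Λ → M` is a diffeomorphism whose inverse is `(p, F)`. -/
structure IsProductDiffeo (S : N × Λ → M) (p : M → N) (F : M → Λ) : Prop where
  smooth : ContMDiff ((𝓡 k).prod (𝓡 l)) (𝓡 d) ∞ S
  smooth_fst : ContMDiff (𝓡 d) (𝓡 k) ∞ p
  smooth_snd : ContMDiff (𝓡 d) (𝓡 l) ∞ F
  fst_apply : ∀ n lam, p (S (n, lam)) = n
  snd_apply : ∀ n lam, F (S (n, lam)) = lam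
  apply_eq : ∀ m, S (p m, F m) = m

namespace IsProductDiffeo

variable {S : N × Λ → M} {p : M → N} {F : M → Λ}

theorem isLocalDiffeomorph (h : IsProductDiffeo (d := d) (k := k) (l := l) S p F) :
    IsLocalDiffeomorph ((𝓡 k).prod (𝓡 l)) (𝓡 d) ∞ S := fun _ =>
  ⟨{ toFun := S
     invFun := fun m => (p m, F m)
     source := univ
     target := univ
     map_source' := fun _ _ => mem_univ _
     map_target' := fun _ _ => mem_univ _
     left_inv' := fun _ _ => Prod.ext (h.fst_apply _ _) (h.snd_apply _ _)
     right_inv' := fun m _ => h.apply_eq m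
     open_source := isOpen_univ
     open_target := isOpen_univ
     contMDiffOn_toFun := h.smooth.contMDiffOn
     contMDiffOn_invFun := (h.smooth_fst.prodMk h.smooth_snd).contMDiffOn }, mem_univ _,
    fun _ _ => rfl⟩

theorem smooth_section (h : IsProductDiffeo (d := d) (k := k) (l := l) S p F) (lam : Λ) :
    ContMDiff (𝓡 k) (𝓡 d) ∞ (fun n => S (n, lam)) :=
  h.smooth.comp (contMDiff_id.prodMk contMDiff_const)

theorem mfderiv_fst_section (h : IsProductDiffeo (d := d) (k := k) (l := l) S p F)
    (n : N) (lam : Λ) (v : EuclideanSpace ℝ (Fin k)) :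
    mfderiv (𝓡 d) (𝓡 k) p (S (n, lam)) (mfderiv (𝓡 k) (𝓡 d) (fun n' => S (n', lam)) n v) = v := by
  have h1 := mfderiv_comp_apply n (I' := 𝓡 d) (f := fun n' => S (n', lam)) (g := p)
    ((h.smooth_fst _).mdifferentiableAt (by simp))
    ((h.smooth_section lam n).mdifferentiableAt (by simp)) v
  have h2 : p ∘ (fun n' => S (n', lam)) = id := funext fun n' => h.fst_apply n' lam
  rw [h2, mfderiv_id] at h1
  exact h1.symm

theorem mfderiv_snd_section (h : IsProductDiffeo (d := d) (k := k) (l := l) S p F)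
    (n : N) (lam : Λ) (v : EuclideanSpace ℝ (Fin k)) :
    mfderiv (𝓡 d) (𝓡 l) F (S (n, lam)) (mfderiv (𝓡 k) (𝓡 d) (fun n' => S (n', lam)) n v) = 0 := by
  have h1 := mfderiv_comp_apply n (I' := 𝓡 d) (f := fun n' => S (n', lam)) (g := F)
    ((h.smooth_snd _).mdifferentiableAt (by simp))
    ((h.smooth_section lam n).mdifferentiableAt (by simp)) v
  have h2 : F ∘ (fun n' => S (n', lam)) = fun _ => lam := funext fun n' => h.snd_apply n' lam
  rw [h2, mfderiv_const] at h1
  exact h1.symm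

theorem surjective_mfderiv_fst (h : IsProductDiffeo (d := d) (k := k) (l := l) S p F) (m : M) :
    Function.Surjective (mfderiv (𝓡 d) (𝓡 k) p m) := by
  rw [← h.apply_eq m]
  exact fun v => ⟨_, h.mfderiv_fst_section _ _ v⟩

theorem surjective_mfderiv_snd (h : IsProductDiffeo (d := d) (k := k) (l := l) S p F) (m : M) :
    Function.Surjective (mfderiv (𝓡 d) (𝓡 l) F m) := by
  rw [← h.apply_eq m]
  intro v
  have hs : ContMDiff (𝓡 l) (𝓡 d) ∞ (fun b => S (p m, b)) :=
    h.smooth.comp (contMDiff_const.prodMk contMDiff_id)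
  have h1 := mfderiv_comp_apply (F m) (I' := 𝓡 d) (f := fun b => S (p m, b)) (g := F)
    ((h.smooth_snd _).mdifferentiableAt (by simp))
    ((hs _).mdifferentiableAt (by simp)) v
  have h2 : F ∘ (fun b => S (p m, b)) = id := funext fun b => h.snd_apply _ b
  rw [h2, mfderiv_id] at h1
  exact ⟨_, h1.symm⟩

/-- Differentiating `S ∘ (p, F) = id` writes `w` as the sum of the partial derivatives of `S` along
`p_* w` and `F_* w`. The second term vanishes, so `v = p_* w` works. -/
theorem exists_mfderiv_section_eq (h : IsProductDiffeo (d := d) (k := k) (l := l) S p F) (m : M)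
    (w : EuclideanSpace ℝ (Fin d)) (hw : mfderiv (𝓡 d) (𝓡 l) F m w = 0) :
    ∃ v : EuclideanSpace ℝ (Fin k),
      mfderiv (𝓡 k) (𝓡 d) (fun n' => S (n', F m)) (p m) v = w := by
  have hp := (h.smooth_fst m).mdifferentiableAt (n := ∞) (by simp)
  have hF := (h.smooth_snd m).mdifferentiableAt (n := ∞) (by simp)
  have hS := (h.smooth (p m, F m)).mdifferentiableAt (n := ∞) (by simp)
  have h1 := mfderiv_comp_apply m (f := fun m => (p m, F m)) hS (hp.prodMk hF) w
  have h2 : S ∘ (fun m => (p m, F m)) = id := funext h.apply_eq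
  rw [h2, mfderiv_id, mfderiv_prodMk hp hF] at h1
  have h3 := mfderiv_prod_eq_add_apply (I := 𝓡 k) (I' := 𝓡 l) (I'' := 𝓡 d)
    (p := (p m, F m)) (v := (mfderiv (𝓡 d) (𝓡 k) p m w, mfderiv (𝓡 d) (𝓡 l) F m w)) hS
  refine ⟨mfderiv (𝓡 d) (𝓡 k) p m w, ?_⟩
  simp only [hw, map_zero, add_zero] at h3
  refine h3.symm.trans (Eq.trans ?_ h1.symm)
  rw [← hw]
  rfl

/-- The images of the partial sections are the vertical spaces of the second projection. -/
theorem vertical_snd (h : IsProductDiffeo (d := d) (k := k) (l := l) S p F) (n : N) (lam : Λ) :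
    vertical (d := d) (k := l) F (S (n, lam)) =
      LinearMap.range (mfderiv (𝓡 k) (𝓡 d) (fun n' => S (n', lam)) n).toLinearMap := by
  refine le_antisymm (fun w hw => ?_) ?_
  · have := h.exists_mfderiv_section_eq (S (n, lam)) w hw
    rwa [h.fst_apply, h.snd_apply] at this
  · rintro _ ⟨v, rfl⟩
    exact h.mfderiv_snd_section n lam v

end IsProductDiffeo

end ProductDiffeomorphism

/-! ### Integral manifolds from injective immersions -/

section Integrability

variable {d : ℕ} {M : Type*} [TopologicalSpace M] [ChartedSpace (EuclideanSpace ℝ (Fin d)) M]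

/-- A distribution is integrable if through every point there is an injective immersion of a
manifold that is everywhere tangent to it. -/
theorem isIntegrable_of_immersions {D : ∀ m : M, Submodule ℝ (TangentSpace (𝓡 d) m)} {k : ℕ}
    {N : Type*} [TopologicalSpace N] [ChartedSpace (EuclideanSpace ℝ (Fin k)) N]
    [IsManifold (𝓡 k) ∞ N]
    (h : ∀ m : M, ∃ (σ : N → M) (n : N), σ n = m ∧ ContMDiff (𝓡 k) (𝓡 d) ∞ σ ∧
      Function.Injective σ ∧ ∀ n', Function.Injective (mfderiv (𝓡 k) (𝓡 d) σ n') ∧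
        LinearMap.range (mfderiv (𝓡 k) (𝓡 d) σ n').toLinearMap = D (σ n')) :
    IsIntegrable D := by
  intro m
  obtain ⟨σ, n, rfl, hσ, hinj, hD⟩ := h m
  let φ := chartAt (EuclideanSpace ℝ (Fin k)) n
  -- `IsIntegrable` asks for a parametrization centred at `0`; the translation moves `0` to `φ n`.
  let τ : EuclideanSpace ℝ (Fin k) → EuclideanSpace ℝ (Fin k) := fun x => x + φ n
  have hτ : ContMDiff (𝓡 k) (𝓡 k) ∞ τ := (contDiff_id.add contDiff_const).contMDiff
  have hφ : ContMDiffOn (𝓡 k) (𝓡 k) ∞ φ.symm φ.target := contMDiffOn_chart_symm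
  have hφ' : ContMDiffOn (𝓡 k) (𝓡 k) ∞ φ φ.source := contMDiffOn_chart
  refine ⟨k, τ ⁻¹' φ.target, fun x => σ (φ.symm (τ x)), φ.open_target.preimage hτ.continuous,
    ?_, ?_, ?_, ?_, ?_⟩
  · simp [τ, φ]
  · simp [τ, φ]
  · exact hσ.comp_contMDiffOn (hφ.comp hτ.contMDiffOn fun x hx => hx)
  · intro x hx y hy hxy
    have := φ.symm.injOn hx hy (hinj hxy)
    simpa [τ] using this
  · intro w hw
    have hw' : φ.symm (τ w) ∈ φ.source := φ.map_target hw
    have d1 : MDifferentiableAt (𝓡 k) (𝓡 k) φ.symm (τ w) :=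
      (hφ.contMDiffAt (φ.open_target.mem_nhds hw)).mdifferentiableAt (by simp)
    have d2 : MDifferentiableAt (𝓡 k) (𝓡 k) φ (φ.symm (τ w)) :=
      (hφ'.contMDiffAt (φ.open_source.mem_nhds hw')).mdifferentiableAt (by simp)
    have d3 : MDifferentiableAt (𝓡 k) (𝓡 k) τ w := (hτ w).mdifferentiableAt (by simp)
    have d4 : MDifferentiableAt (𝓡 k) (𝓡 d) σ (φ.symm (τ w)) :=
      (hσ _).mdifferentiableAt (by simp)
    have e3 : mfderiv (𝓡 k) (𝓡 k) τ w = ContinuousLinearMap.id ℝ _ := by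
      rw [mfderiv_eq_fderiv]
      exact (fderiv_add_const _).trans fderiv_fun_id
    have e1 : mfderiv (𝓡 k) (𝓡 k) (φ.symm ∘ τ) w = mfderiv (𝓡 k) (𝓡 k) φ.symm (τ w) := by
      rw [mfderiv_comp w d1 d3, e3]
      rfl
    have e2 : mfderiv (𝓡 k) (𝓡 d) (fun x => σ (φ.symm (τ x))) w =
        (mfderiv (𝓡 k) (𝓡 d) σ (φ.symm (τ w))).comp (mfderiv (𝓡 k) (𝓡 k) φ.symm (τ w)) := by
      rw [← e1]
      exact mfderiv_comp w d4 (d1.comp w d3)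
    -- Precomposition with a bijection changes neither the injectivity nor the range of the
    -- derivative of `σ`.
    have hb : Function.Bijective (mfderiv (𝓡 k) (𝓡 k) φ.symm (τ w)) :=
      have : IsManifold (𝓡 k) 1 N := .of_le (n := ∞) (by simp)
      (mdifferentiable_chart (I := 𝓡 k) n).symm.mfderiv_bijective hw
    obtain ⟨hD1, hD2⟩ := hD (φ.symm (τ w))
    rw [e2]
    refine ⟨hD1.comp hb.1, ?_⟩
    rw [← hD2]
    exact LinearMap.range_comp_of_range_eq_top _ (LinearMap.range_eq_top.2 hb.2)

end Integrability

/-! ### The Hamilton-Jacobi equation as tangency -/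

section Solutions

variable {d : ℕ} {M : Type*} [TopologicalSpace M] [ChartedSpace (EuclideanSpace ℝ (Fin d)) M]
variable {k : ℕ} {N : Type*} [TopologicalSpace N] [ChartedSpace (EuclideanSpace ℝ (Fin k)) N]
variable {l : ℕ} {Λ : Type*} [TopologicalSpace Λ] [ChartedSpace (EuclideanSpace ℝ (Fin l)) Λ]

/-- The equation lives in the total space of the tangent bundle, where the base point of `v` is `p
(σ n)`, only propositionally equal to `n`. Keeping it as the hypothesis `hv` allows substitution
before the fibers are compared. -/
theorem mem_range_mfderiv_of_tangentMap_eq {σ : N → M} {n : N}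
    {x : TangentSpace (𝓡 d) (σ n)} {v : TangentBundle (𝓡 k) N} (hv : v.1 = n)
    (h : tangentMap (𝓡 k) (𝓡 d) σ v = (⟨σ n, x⟩ : TangentBundle (𝓡 d) M)) :
    x ∈ LinearMap.range (mfderiv (𝓡 k) (𝓡 d) σ n).toLinearMap := by
  obtain ⟨n', v⟩ := v
  obtain rfl : n' = n := hv
  have h' : (⟨σ n', mfderiv (𝓡 k) (𝓡 d) σ n' v⟩ : TangentBundle (𝓡 d) M) = ⟨σ n', x⟩ := h
  rw [TotalSpace.mk_inj] at h'
  exact ⟨v, h'⟩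

/-- A solution of the Hamilton-Jacobi equation is tangent to the vector field. -/
theorem IsSolution.mem_range {p : M → N} {X : ∀ m : M, TangentSpace (𝓡 d) m} {σ : N → M}
    (h : IsSolution (d := d) (k := k) p X σ) (n : N) :
    X (σ n) ∈ LinearMap.range (mfderiv (𝓡 k) (𝓡 d) σ n).toLinearMap :=
  mem_range_mfderiv_of_tangentMap_eq (h.isSection n) (h.equation n)

/-- A smooth section that is tangent to a vector field solves the Hamilton-Jacobi equation. -/
theorem isSolution_of_mem_range {p : M → N} {X : ∀ m : M, TangentSpace (𝓡 d) m} {σ : N → M}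
    (hp : ContMDiff (𝓡 d) (𝓡 k) ∞ p) (hσ : ContMDiff (𝓡 k) (𝓡 d) ∞ σ) (hs : ∀ n, p (σ n) = n)
    (hX : ∀ n, X (σ n) ∈ LinearMap.range (mfderiv (𝓡 k) (𝓡 d) σ n).toLinearMap) :
    IsSolution (d := d) (k := k) p X σ := by
  refine ⟨hσ, hs, fun n => ?_⟩
  -- If `X = σ_* v`, then `p_* X = v` because `p ∘ σ = id`, and `σ_*` returns `X`.
  obtain ⟨v, hv⟩ := hX n
  have h1 : (⟨σ n, X (σ n)⟩ : TangentBundle (𝓡 d) M) =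
      tangentMap (𝓡 k) (𝓡 d) σ (⟨n, v⟩ : TangentBundle (𝓡 k) N) := by
    rw [← hv]
    rfl
  have h2 : p ∘ σ = id := funext hs
  have h3 := tangentMap_comp_at (I := 𝓡 k) (I' := 𝓡 d) (I'' := 𝓡 k) (f := σ) (g := p)
    (⟨n, v⟩ : TangentBundle (𝓡 k) N) ((hp _).mdifferentiableAt (by simp))
    ((hσ _).mdifferentiableAt (by simp))
  rw [h2, tangentMap_id] at h3
  rw [h1, ← h3]
  rfl

variable {S : N × Λ → M} {p : M → N} {F : M → Λ}

/-- A product decomposition whose first slices are Lagrangian and tangent to the Hamiltonian vector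
field makes the system commutative integrable by means of the second projection. -/
theorem IsProductDiffeo.isCIBy [IsManifold (𝓡 k) ∞ N] [Nonempty N]
    (h : IsProductDiffeo (d := d) (k := k) (l := l) S p F) {Ξ : BivectorField d M} {H : M → ℝ}
    (hL : IsLagrangianFamily (d := d) (k := k) Ξ S)
    (hX : ∀ n lam, hamiltonianVectorField Ξ H (S (n, lam)) ∈
      LinearMap.range (mfderiv (𝓡 k) (𝓡 d) (fun n' => S (n', lam)) n).toLinearMap) :
    IsCIBy (l := l) Ξ H F := by
  have hLag : ∀ m, IsLagrangian Ξ (vertical (d := d) (k := l) F m) := by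
    intro m
    rw [← h.apply_eq m, h.vertical_snd]
    exact hL _ _
  refine ⟨⟨⟨h.smooth_snd, ?_, h.surjective_mfderiv_snd⟩, fun m => (hLag m).1, ?_, ?_⟩, hLag⟩
  · exact fun lam => ⟨S (Classical.arbitrary N, lam), h.snd_apply _ _⟩
  · intro m
    rw [← h.apply_eq m, h.vertical_snd]
    exact hX _ _
  -- The integral manifolds are the slices `n ↦ S (n, F m)`. Both the slices and their differentials
  -- are injective because `p` is a left inverse.
  · refine isIntegrable_of_immersions (N := N) fun m =>
      ⟨fun n => S (n, F m), p m, h.apply_eq m, h.smooth_section _, fun n n' hn => ?_,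
        fun n => ⟨fun v v' hv => ?_, ?_⟩⟩
    · have := congrArg p hn
      simpa only [h.fst_apply] using this
    · rw [← h.mfderiv_fst_section n (F m) v, ← h.mfderiv_fst_section n (F m) v', hv]
    · rw [(hLag _).orthogonal_eq, h.vertical_snd]

/-- If the second projection of a product decomposition has Lagrangian fibers tangent to the
Hamiltonian vector field, the decomposition is a Lagrangian complete solution. -/
theorem IsProductDiffeo.isCompleteSolution
    (h : IsProductDiffeo (d := d) (k := k) (l := l) S p F) (hd : d = k + l)
    {Ξ : BivectorField d M} {H : M → ℝ}
    (hL : ∀ m, IsLagrangian Ξ (vertical (d := d) (k := l) F m))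
    (hX : ∀ m, hamiltonianVectorField Ξ H m ∈ vertical (d := d) (k := l) F m) :
    IsCompleteSolution (d := d) (k := k) (l := l) p (hamiltonianVectorField Ξ H) S ∧
      IsLagrangianFamily (d := d) (k := k) Ξ S := by
  refine ⟨⟨hd, fun m => ⟨_, h.apply_eq m⟩, h.isLocalDiffeomorph, fun lam =>
    isSolution_of_mem_range h.smooth_fst (h.smooth_section lam) (fun n => h.fst_apply n lam)
      fun n => ?_⟩, fun lam n => ?_⟩
  · rw [← h.vertical_snd]
    exact hX _
  · rw [← h.vertical_snd]
    exact hL _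

end Solutions

/-! ### Local passage between solutions and fibrations -/

section Localization

variable {d : ℕ} {M : Type u} [TopologicalSpace M] [ChartedSpace (EuclideanSpace ℝ (Fin d)) M]
variable {k : ℕ} {N : Type v} [TopologicalSpace N] [ChartedSpace (EuclideanSpace ℝ (Fin k)) N]
variable {l : ℕ} {Λ : Type w} [TopologicalSpace Λ] [ChartedSpace (EuclideanSpace ℝ (Fin l)) Λ]

/-- A partial diffeomorphism from `N × Λ` to `M` restricts to a diffeomorphism from a product of
open sets onto an open set. -/
theorem exists_isProductDiffeo_restrict
    (Φ : PartialDiffeomorph ((𝓡 k).prod (𝓡 l)) (𝓡 d) (N × Λ) M ∞)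
    {x₀ : N × Λ} (hx₀ : x₀ ∈ Φ.source) {S : N × Λ → M} {p : M → N} {F : M → Λ}
    (hS : EqOn S Φ Φ.source) (hpF : EqOn (fun m => (p m, F m)) Φ.symm Φ.target) :
    ∃ (A : Opens N) (B : Opens Λ) (U : Opens M) (S' : A × B → U) (p' : U → A) (F' : U → B),
      x₀.1 ∈ A ∧ x₀.2 ∈ B ∧ S x₀ ∈ U ∧
      IsProductDiffeo (d := d) (k := k) (l := l) S' p' F' ∧
      (∀ x, (S' x : M) = S (x.1, x.2)) ∧ (∀ u, (p' u : N) = p u) ∧ ∀ u, (F' u : Λ) = F u := by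
  obtain ⟨A, B, hA, hxA, hB, hxB, hAB⟩ :=
    mem_nhds_prod_iff'.1 (Φ.open_source.mem_nhds hx₀)
  -- This set is `Φ (A × B)`, since `A × B` lies in the source; as a preimage it is visibly open.
  have hUo : IsOpen (Φ.target ∩ Φ.symm ⁻¹' (A ×ˢ B)) :=
    Φ.symm.contMDiffOn_toFun.continuousOn.isOpen_inter_preimage Φ.open_target (hA.prod hB)
  have hleft : ∀ x ∈ A ×ˢ B, (p (S x), F (S x)) = x := fun x hx => by
    rw [hS (hAB hx)]
    exact (hpF (Φ.map_source (hAB hx))).trans (Φ.left_inv (hAB hx))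
  have hmap : ∀ x ∈ A ×ˢ B, S x ∈ Φ.target ∩ Φ.symm ⁻¹' (A ×ˢ B) := fun x hx => by
    have ht : S x ∈ Φ.target := by
      rw [hS (hAB hx)]
      exact Φ.map_source (hAB hx)
    refine ⟨ht, ?_⟩
    rw [mem_preimage, ← hpF ht]
    dsimp only
    rwa [hleft x hx]
  have hinv : ∀ m ∈ Φ.target ∩ Φ.symm ⁻¹' (A ×ˢ B), (p m, F m) ∈ A ×ˢ B := fun m hm => by
    rw [show (p m, F m) = Φ.symm m from hpF hm.1]
    exact hm.2
  have hright : ∀ m ∈ Φ.target ∩ Φ.symm ⁻¹' (A ×ˢ B), S (p m, F m) = m := fun m hm => by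
    rw [hS (hAB (hinv m hm)), show (p m, F m) = Φ.symm m from hpF hm.1]
    exact Φ.right_inv hm.1
  have hSs : ContMDiffOn ((𝓡 k).prod (𝓡 l)) (𝓡 d) ∞ S Φ.source := Φ.contMDiffOn.congr hS
  have hpFs : ContMDiffOn (𝓡 d) ((𝓡 k).prod (𝓡 l)) ∞ (fun m => (p m, F m)) Φ.target :=
    Φ.symm.contMDiffOn.congr hpF
  let A' : Opens N := ⟨A, hA⟩
  let B' : Opens Λ := ⟨B, hB⟩
  let U' : Opens M := ⟨_, hUo⟩
  refine ⟨A', B', U', fun x => ⟨S (x.1, x.2), hmap _ ⟨x.1.2, x.2.2⟩⟩,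
    fun u => ⟨p u, (hinv _ u.2).1⟩, fun u => ⟨F u, (hinv _ u.2).2⟩, hxA, hxB, hmap x₀ ⟨hxA, hxB⟩,
    ⟨?_, ?_, ?_, ?_, ?_, ?_⟩, fun _ => rfl, fun _ => rfl, fun _ => rfl⟩
  · rw [← ContMDiff.subtypeVal_comp_iff]
    have hval : ContMDiff ((𝓡 k).prod (𝓡 l)) ((𝓡 k).prod (𝓡 l)) ∞
        (fun x : A' × B' => ((x.1 : N), (x.2 : Λ))) :=
      (contMDiff_subtype_val.comp contMDiff_fst).prodMk (contMDiff_subtype_val.comp contMDiff_snd)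
    exact hSs.comp_contMDiff hval fun x => hAB ⟨x.1.2, x.2.2⟩
  · rw [← ContMDiff.subtypeVal_comp_iff]
    exact contMDiff_fst.comp (hpFs.comp_contMDiff contMDiff_subtype_val fun u : U' => u.2.1)
  · rw [← ContMDiff.subtypeVal_comp_iff]
    exact contMDiff_snd.comp (hpFs.comp_contMDiff contMDiff_subtype_val fun u : U' => u.2.1)
  · exact fun n lam => Subtype.ext (congrArg Prod.fst (hleft (n, lam) ⟨n.2, lam.2⟩))
  · exact fun n lam => Subtype.ext (congrArg Prod.snd (hleft (n, lam) ⟨n.2, lam.2⟩))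
  · exact fun u => Subtype.ext (hright u u.2)

/-- A Lagrangian complete solution makes the system locally commutative integrable. -/
theorem exists_isCI_of_isCompleteSolution [IsManifold (𝓡 k) ∞ N] [IsManifold (𝓡 l) ∞ Λ]
    [T2Space Λ] [SecondCountableTopology Λ] {Ξ : BivectorField d M} {H : M → ℝ}
    (hH : ContMDiff (𝓡 d) 𝓘(ℝ, ℝ) ∞ H) {p : M → N} {S : N × Λ → M}
    (hS : IsCompleteSolution (d := d) (k := k) (l := l) p (hamiltonianVectorField Ξ H) S)
    (hL : IsLagrangianFamily (d := d) (k := k) Ξ S) (m : M) :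
    ∃ U : Opens M, m ∈ U ∧ IsCI.{u, w} (restrictBivector Ξ U) (fun x : U => H x) := by
  obtain ⟨x₀, rfl⟩ := hS.surjective m
  obtain ⟨Φ, hx₀, hΦ⟩ := hS.localDiffeo x₀
  obtain ⟨A, B, U, S', p', F', hxA, -, hxU, h, hS', -, -⟩ :=
    exists_isProductDiffeo_restrict Φ hx₀ (p := fun m => (Φ.symm m).1)
      (F := fun m => (Φ.symm m).2) hΦ fun _ _ => rfl
  have hder : ∀ (n : A) (lam : B), mfderiv (𝓡 k) (𝓡 d) (fun n' => S' (n', lam)) n =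
      mfderiv (𝓡 k) (𝓡 d) (fun n' => S (n', lam)) (n : N) := fun n lam =>
    mfderiv_of_comp_val (fun n' => hS' (n', lam)) n ((hS.partialSolution lam).smooth n)
  have : Nonempty A := ⟨⟨x₀.1, hxA⟩⟩
  refine ⟨U, hxU, l, B, inferInstance, inferInstance, inferInstance, inferInstance, inferInstance,
    F', h.isCIBy (fun lam n => ?_) fun n lam => ?_⟩
  -- The base points `S' (n, lam)` and `S (n, lam)` are only propositionally equal here, and the
  -- predicate depends on them. Generalizing over `m'` permits substitution.
  · have key : ∀ m', m' = S (n, lam) → IsLagrangian Ξ (m := m') (LinearMap.range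
        (mfderiv (𝓡 k) (𝓡 d) (fun n' => S (n', lam)) (n : N)).toLinearMap) := by
      rintro _ rfl
      exact hL lam n
    rw [hder]
    exact (isLagrangian_restrictBivector Ξ U _ _).2 (key _ (hS' (n, lam)))
  · have key : ∀ m', m' = S (n, lam) → hamiltonianVectorField Ξ H m' ∈ LinearMap.range
        (mfderiv (𝓡 k) (𝓡 d) (fun n' => S (n', lam)) (n : N)).toLinearMap := by
      rintro _ rfl
      exact (hS.partialSolution lam).mem_range n
    rw [hder, hamiltonianVectorField_restrictBivector _ _ _ ((hH _).mdifferentiableAt (by simp))]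
    exact key _ (hS' (n, lam))

/-- If the system is commutative integrable by means of `F`, then a map that is transverse to `F`
at a point has a Lagrangian complete solution near that point. -/
theorem exists_hasLagrangianCompleteSolution [IsManifold (𝓡 d) ∞ M] [IsManifold (𝓡 k) ∞ N]
    [IsManifold (𝓡 l) ∞ Λ] [T2Space Λ] [SecondCountableTopology Λ] {Ξ : BivectorField d M} {H : M → ℝ}
    (hH : ContMDiff (𝓡 d) 𝓘(ℝ, ℝ) ∞ H) {F : M → Λ} (hF : IsCIBy (l := l) Ξ H F)
    {p : M → N} {O : Set M} (hO : IsOpen O) (hp : ContMDiffOn (𝓡 d) (𝓡 k) ∞ p O)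
    {m : M} (hm : m ∈ O) (hd : d = k + l)
    (hker : Disjoint (vertical (d := d) (k := k) p m) (vertical (d := d) (k := l) F m)) :
    ∃ (U : Opens M) (V : Opens N) (q : U → V), m ∈ U ∧ (∀ u, (q u : N) = p u) ∧
      IsFibration (d := d) (k := k) q ∧ HasLagrangianCompleteSolution.{u, v, w} (d := d) (k := k)
        (restrictBivector Ξ U) (fun x : U => H x) q := by
  have hFs := hF.fibration.smooth
  have hpm := (hp.contMDiffAt (hO.mem_nhds hm)).mdifferentiableAt (n := ∞) (by simp)
  have hFm := (hFs m).mdifferentiableAt (n := ∞) (by simp)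
  -- The kernel of `D = (p, F)_*` is the intersection of the two vertical spaces, hence zero; `d = k
  -- + l` then makes `D` an isomorphism.
  let D : EuclideanSpace ℝ (Fin d) →L[ℝ] EuclideanSpace ℝ (Fin k) × EuclideanSpace ℝ (Fin l) :=
    ContinuousLinearMap.prod (mfderiv (𝓡 d) (𝓡 k) p m) (mfderiv (𝓡 d) (𝓡 l) F m)
  have hinj : Function.Injective D.toLinearMap := by
    rw [← LinearMap.ker_eq_bot, eq_bot_iff]
    intro w hw
    have hw' : D w = 0 := hw
    exact hker.le_bot ⟨congrArg Prod.fst hw', congrArg Prod.snd hw'⟩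
  let e : EuclideanSpace ℝ (Fin d) ≃L[ℝ] EuclideanSpace ℝ (Fin k) × EuclideanSpace ℝ (Fin l) :=
    (LinearEquiv.ofInjectiveOfFinrankEq D.toLinearMap hinj (by simp [hd])).toContinuousLinearEquiv
  have he : mfderiv (𝓡 d) ((𝓡 k).prod (𝓡 l)) (fun m => (p m, F m)) m =
      (e : EuclideanSpace ℝ (Fin d) →L[ℝ]
        EuclideanSpace ℝ (Fin k) × EuclideanSpace ℝ (Fin l)) := by
    rw [mfderiv_prodMk hpm hFm]
    rfl
  obtain ⟨Φ, hmΦ, hΦ⟩ := isLocalDiffeomorphAt_of_mfderiv hO hm (hp.prodMk hFs.contMDiffOn) he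
  have hΦm : Φ.symm (Φ m) = m := Φ.left_inv hmΦ
  -- Here `Φ` is the local form of `(p, F)`, so its inverse plays the role of `S`.
  obtain ⟨A, B, U, S', p', F', -, hxB, hxU, h, -, hp', hF'⟩ :=
    exists_isProductDiffeo_restrict Φ.symm (x₀ := Φ m) (Φ.map_source hmΦ) (S := Φ.symm)
      (fun _ _ => rfl) hΦ
  rw [hΦm] at hxU
  have hv : ∀ u : U, vertical (d := d) (k := l) F' u = vertical (d := d) (k := l) F (u : M) := by
    intro u
    unfold vertical
    rw [mfderiv_of_comp_val hF' u (hFs u)]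
    rfl
  obtain ⟨h1, h2⟩ := h.isCompleteSolution hd (Ξ := restrictBivector Ξ U) (H := fun x : U => H x)
    (fun u => by
      rw [hv]
      exact (isLagrangian_restrictBivector Ξ U _ _).2 (hF.lagrangian u))
    (fun u => by
      rw [hv, hamiltonianVectorField_restrictBivector _ _ _ ((hH _).mdifferentiableAt (by simp))]
      exact hF.firstIntegrals u)
  exact ⟨U, A, p', hxU, hp',
    ⟨h.smooth_fst, fun n => ⟨S' (n, ⟨_, hxB⟩), h.fst_apply _ _⟩, h.surjective_mfderiv_fst⟩,
    l, B, inferInstance, inferInstance, inferInstance, inferInstance, inferInstance, S', h1, h2⟩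

end Localization

/-! ### Dimension count and existence of transverse maps -/

section Transversality

variable {d : ℕ} {M : Type*} [TopologicalSpace M] [ChartedSpace (EuclideanSpace ℝ (Fin d)) M]
variable {k : ℕ} {N : Type*} [TopologicalSpace N] [ChartedSpace (EuclideanSpace ℝ (Fin k)) N]
variable {l : ℕ} {Λ : Type*} [TopologicalSpace Λ] [ChartedSpace (EuclideanSpace ℝ (Fin l)) Λ]

theorem finrank_vertical_add {p : M → N} (hp : IsFibration (d := d) (k := k) p) (m : M) :
    k + Module.finrank ℝ (vertical (d := d) (k := k) p m) = d := by
  let D : EuclideanSpace ℝ (Fin d) →ₗ[ℝ] EuclideanSpace ℝ (Fin k) :=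
    (mfderiv (𝓡 d) (𝓡 k) p m).toLinearMap
  have h := D.finrank_range_add_finrank_ker
  have hD : LinearMap.range D = ⊤ := LinearMap.range_eq_top.2 (hp.submersion m)
  rw [hD, finrank_top, finrank_euclideanSpace_fin,
    finrank_euclideanSpace_fin] at h
  exact h

/-- The base dimensions of transverse fibrations add up to the dimension of the manifold. -/
theorem Transverse.dim_eq {p : M → N} {F : M → Λ} (hp : IsFibration (d := d) (k := k) p)
    (hF : IsFibration (d := d) (k := l) F) (h : Transverse (d := d) (k := k) (l := l) p F) (m : M) :
    d = k + l := by
  have h1 := finrank_vertical_add hp m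
  have h2 := finrank_vertical_add hF m
  have h3 := Submodule.finrank_add_eq_of_isCompl (h m)
  have h4 : Module.finrank ℝ (TangentSpace (𝓡 d) m) = d := finrank_euclideanSpace_fin
  omega

/-- The tangent space at `m` is modelled through the preferred chart at `m`, in which that chart
reads as the identity. -/
theorem mfderiv_chartAt_self (m : M) :
    mfderiv (𝓡 d) (𝓡 d) (chartAt (EuclideanSpace ℝ (Fin d)) m) m =
      ContinuousLinearMap.id ℝ (EuclideanSpace ℝ (Fin d)) := by
  let φ := chartAt (EuclideanSpace ℝ (Fin d)) m
  have h : writtenInExtChartAt (𝓡 d) (𝓡 d) m φ =ᶠ[nhds (extChartAt (𝓡 d) m m)] id := by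
    filter_upwards [φ.open_target.mem_nhds (mem_chart_target _ m)] with y hy
    simp only [writtenInExtChartAt, extChartAt, mfld_simps]
    exact φ.right_inv hy
  have hmf : HasMFDerivAt (𝓡 d) (𝓡 d) φ m
      (ContinuousLinearMap.id ℝ (EuclideanSpace ℝ (Fin d))) :=
    ⟨φ.continuousAt (mem_chart_source _ m),
      ((hasFDerivAt_id _).congr_of_eventuallyEq h).hasFDerivWithinAt⟩
  exact hmf.mfderiv

/-- Near every point there is a Euclidean-valued map transverse to a given fibration. -/
theorem exists_disjoint_vertical [IsManifold (𝓡 d) ∞ M] {F : M → Λ}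
    (hF : IsFibration (d := d) (k := l) F) (m : M) :
    ∃ (r : ℕ) (p : M → EuclideanSpace ℝ (Fin r)) (O : Set M), IsOpen O ∧ m ∈ O ∧
      ContMDiffOn (𝓡 d) (𝓡 r) ∞ p O ∧ d = r + l ∧
      Disjoint (vertical (d := d) (k := r) p m) (vertical (d := d) (k := l) F m) := by
  let K : Submodule ℝ (EuclideanSpace ℝ (Fin d)) := vertical (d := d) (k := l) F m
  -- `T` is a linear projection onto `K = Ker F_{*,m}`. The chart has derivative `id` at `m`, so `L
  -- ∘ φ` has derivative `ε ∘ T` there, which is injective on `K`. Thus `r` is the fiber dimension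
  -- `d - l`.
  obtain ⟨T, hT⟩ := K.subtype.exists_leftInverse_of_injective K.ker_subtype
  let ε : K ≃ₗ[ℝ] EuclideanSpace ℝ (Fin (Module.finrank ℝ K)) :=
    LinearEquiv.ofFinrankEq _ _ (by simp)
  let L : EuclideanSpace ℝ (Fin d) →L[ℝ] EuclideanSpace ℝ (Fin (Module.finrank ℝ K)) :=
    LinearMap.toContinuousLinearMap (ε.toLinearMap ∘ₗ T)
  let φ := chartAt (EuclideanSpace ℝ (Fin d)) m
  have hφ : ContMDiffOn (𝓡 d) (𝓡 d) ∞ φ φ.source := contMDiffOn_chart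
  have hL : ContMDiff (𝓡 d) (𝓡 (Module.finrank ℝ K)) ∞ L := L.contDiff.contMDiff
  refine ⟨Module.finrank ℝ K, L ∘ φ, φ.source, φ.open_source, mem_chart_source _ m,
    hL.comp_contMDiffOn hφ, ?_, ?_⟩
  · have := finrank_vertical_add hF m
    exact (add_comm _ _).trans this |>.symm
  · rw [Submodule.disjoint_def]
    intro w hw hwF
    have hφm : MDifferentiableAt (𝓡 d) (𝓡 d) φ m :=
      (hφ.contMDiffAt (φ.open_source.mem_nhds (mem_chart_source _ m))).mdifferentiableAt (by simp)
    have h1 := mfderiv_comp m ((hL (φ m)).mdifferentiableAt (by simp)) hφm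
    rw [mfderiv_chartAt_self, mfderiv_eq_fderiv, L.fderiv] at h1
    have hw1 : mfderiv (𝓡 d) (𝓡 (Module.finrank ℝ K)) (L ∘ φ) m w = 0 := hw
    rw [h1] at hw1
    have hw2 : ε (T w) = 0 := hw1
    have hw3 : T w = (⟨w, hwF⟩ : K) := LinearMap.congr_fun hT (⟨w, hwF⟩ : K)
    rw [hw3, LinearEquiv.map_eq_zero_iff] at hw2
    exact congrArg Subtype.val hw2

end Transversality

end HamiltonJacobi

/-! ### The three statements -/

theorem mainTheorem6
    {d : ℕ} {M : Type u} [TopologicalSpace M] [ChartedSpace (EuclideanSpace ℝ (Fin d)) M]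
    [IsManifold (𝓡 d) ∞ M] [T2Space M] [SecondCountableTopology M]
    {k : ℕ} {N : Type v} [TopologicalSpace N] [ChartedSpace (EuclideanSpace ℝ (Fin k)) N]
    [IsManifold (𝓡 k) ∞ N] [T2Space N] [SecondCountableTopology N]
    (Ξ : BivectorField d M) (hΞ : IsPoisson Ξ)
    (H : M → ℝ) (hH : ContMDiff (𝓡 d) 𝓘(ℝ, ℝ) ∞ H)
    (p : M → N) (hp : IsFibration (d := d) (k := k) p) :
    -- (1)
    (HasLagrangianCompleteSolution.{u, v, w} (d := d) (k := k) Ξ H p →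
      ∀ m : M, ∃ U : Opens M, m ∈ U ∧
        IsCI.{u, w} (restrictBivector Ξ U) (fun x : U => H x)) ∧
    -- (2)
    (∀ (l : ℕ) (Λ : Type w) [TopologicalSpace Λ] [ChartedSpace (EuclideanSpace ℝ (Fin l)) Λ]
      [IsManifold (𝓡 l) ∞ Λ] [T2Space Λ] [SecondCountableTopology Λ] (F : M → Λ),
      IsCIBy (l := l) Ξ H F → Transverse (d := d) (k := k) (l := l) p F →
      ∀ m : M, ∃ (U : Opens M) (V : Opens N) (hUV : p '' U = V), m ∈ U ∧
        HasLagrangianCompleteSolution.{u, v, w} (d := d) (k := k)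
          (restrictBivector Ξ U) (fun x : U => H x) (restrictMap p U V hUV)) ∧
    -- (3)
    (IsCI.{u, w} Ξ H →
      ∀ m : M, ∃ (U : Opens M) (r : ℕ) (V : Opens (EuclideanSpace ℝ (Fin r))) (q : U → V),
        m ∈ U ∧ IsFibration (d := d) (k := r) q ∧
        HasLagrangianCompleteSolution.{u, 0, w} (d := d) (k := r)
          (restrictBivector Ξ U) (fun x : U => H x) q) := by

  refine ⟨?_, ?_, ?_⟩
  · rintro ⟨l, Λ, _, _, _, _, _, S, hS, hL⟩ m
    exact exists_isCI_of_isCompleteSolution hH hS hL m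
  · intro l Λ _ _ _ _ _ F hF hpF m
    obtain ⟨U, V, q, hmU, hq, hfib, hsol⟩ := exists_hasLagrangianCompleteSolution hH hF isOpen_univ
      hp.smooth.contMDiffOn (mem_univ m) (hpF.dim_eq hp hF.fibration m) (hpF m).disjoint
    -- `q` is the restriction of `p` to `U` and is onto `V`, so `V` is exactly the image `p(U)`.
    have hUV : p '' U = V := by
      ext n
      constructor
      · rintro ⟨u, hu, rfl⟩
        exact hq ⟨u, hu⟩ ▸ (q ⟨u, hu⟩).2
      · intro hn
        obtain ⟨u, hu⟩ := hfib.surjective ⟨n, hn⟩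
        exact ⟨u, u.2, by rw [← hq, hu]⟩
    have hqr : restrictMap p U V hUV = q := funext fun u => Subtype.ext (hq u).symm
    exact ⟨U, V, hUV, hmU, hqr ▸ hsol⟩
  · rintro ⟨l, Λ, _, _, _, _, _, F, hF⟩ m
    obtain ⟨r, p', O, hO, hmO, hp', hd, hdisj⟩ := exists_disjoint_vertical hF.fibration m
    obtain ⟨U, V, q, hmU, -, hfib, hsol⟩ :=
      exists_hasLagrangianCompleteSolution hH hF hO hp' hmO hd hdisj
    exact ⟨U, r, V, q, hmU, hfib, hsol⟩
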